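/- Let $n \ge 1$ and let $H = (H_1, \dots, H_n)$ with $H_i \in \mathbb{C}[x] = \mathbb{C}[x_1, \dots, x_n]$. Write $x = (x_1, \dots, x_n)$ for the identity map. Assume that $x + H$ is a quasi-translation in dimension $n$ over $\mathbb{C}$, i.e. that $(x - H) \circ (x + H) = x$ as polynomial maps. Call $H$ homogeneous if there is a $d \in \mathbb{N}$ such that each $H_i$ is either zero or homogeneous of degree $d$. (i) If $n \le 3$, then the linear span over $\mathbb{C}$ of the image of $H : \mathbb{C}^n \to \mathbb{C}^n$ has dimension at most $\max\{n-1, 1\}$. (ii) If $H$ is homogeneous and $n \le 4$, then the linear span over $\mathbb{C}$ of the image of $H$ has dimension at most $\max\{n-2, 1\}$. In particular, the dimension of the linear span of the image of $H$ is at most $2$ if $n \le 3$, or if $H$ is homogeneous and $n \le 4$. -/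

import Mathlib

/-- A polynomial map `A^n → A^m`, given by its components `F_1, …, F_m ∈ A[x_1, …, x_n]`. -/
abbrev PolyMap (A : Type*) [CommRing A] (n m : ℕ) : Type _ :=
  Fin m → MvPolynomial (Fin n) A

namespace PolyMap

/-- The identity polynomial map `x = (x_1, …, x_n)`. -/
noncomputable def id (A : Type*) [CommRing A] (n : ℕ) : PolyMap A n n :=
  fun i => MvPolynomial.X i

/-- The composition `F ∘ G = (F_1(G), …, F_k(G))` of polynomial maps. -/
noncomputable def comp {A : Type*} [CommRing A] {n m k : ℕ}
    (F : PolyMap A m k) (G : PolyMap A n m) : PolyMap A n k :=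
  fun i => MvPolynomial.bind₁ G (F i)

/-- The function `A^n → A^m` that a polynomial map defines. -/
noncomputable def toFun {A : Type*} [CommRing A] {n m : ℕ} (F : PolyMap A n m) :
    (Fin n → A) → (Fin m → A) :=
  fun v i => MvPolynomial.eval v (F i)

/-- `x + H` is a quasi-translation: `(x - H) ∘ (x + H) = x`. -/
def IsQuasiTranslation {A : Type*} [CommRing A] {n : ℕ} (H : PolyMap A n n) : Prop :=
  comp (id A n - H) (id A n + H) = id A n

/-- There is a `d ∈ ℕ` such that each component is zero or homogeneous of degree `d`. -/
def IsHomogeneous {A : Type*} [CommRing A] {n m : ℕ} (H : PolyMap A n m) : Prop :=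
  ∃ d : ℕ, ∀ i, H i = 0 ∨ (H i).IsHomogeneous d

/-- The linear span of the image of `H`, as a subspace of `K^m`. -/
noncomputable def imageSpan {K : Type*} [Field K] {n m : ℕ} (H : PolyMap K n m) :
    Submodule K (Fin m → K) :=
  Submodule.span K (Set.range H.toFun)

end PolyMap

/-! The quasi-translation identity makes every `H i` constant on the lines `x + t H(x)`
(`isConstAlong_of_isQuasiTranslation`). In the homogeneous case, dividing `H` by the gcd of its
components gives a homogeneous `G` with coprime components and the same invariance. If the
components of `G` are not all multiples of one of them, then `G` has positive degree and `G(G) = 0`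
(`bind_self_eq_zero`).

The relations among the `G i` form a prime ideal containing the coprime `G i`, hence not principal,
so no `n - 1` components are algebraically independent. For `n ≤ 4` the image of `G` is therefore
projectively at most a curve, and for general `y` some irreducible `P` vanishes at `y` while `G` is
parallel to `G(y)` wherever `P` vanishes (`exists_isFiberFactor`). Choosing `P` of minimal degree
forces it to vanish on the whole span (`exists_isFiberFactor_vanishing_on_imageSpan`). Two such `P`
with non-parallel directions make `G` itself vanish on the span. A span containing a hyperplane
would then give the `G i` a common linear factor, so the codimension is at least two.

The general case in dimension `n ≤ 3` follows by homogenizing with one extra variable. -/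

open MvPolynomial

/-! ### Restriction to lines and evaluation. -/

section Line

variable {σ : Type*}

/-- The restriction of a polynomial to the line `x + T v`. -/
noncomputable def restrictLine (x v : σ → ℂ) : MvPolynomial σ ℂ →ₐ[ℂ] Polynomial ℂ :=
  aeval fun i => Polynomial.C (x i) + Polynomial.C (v i) * Polynomial.X

theorem eval_restrictLine (x v : σ → ℂ) (f : MvPolynomial σ ℂ) (t : ℂ) :
    (restrictLine x v f).eval t = eval (x + t • v) f := by
  induction f using MvPolynomial.induction_on with
  | C a => simp [restrictLine]
  | add p q hp hq => simp [hp, hq]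
  | mul_X p i hp =>
    rw [map_mul, Polynomial.eval_mul, hp]
    simp only [restrictLine, aeval_X, Polynomial.eval_add, Polynomial.eval_mul, Polynomial.eval_C,
      Polynomial.eval_X, map_mul, eval_X, Pi.add_apply, Pi.smul_apply, smul_eq_mul]
    ring

theorem derivative_restrictLine [Fintype σ] (x v : σ → ℂ) (f : MvPolynomial σ ℂ) :
    Polynomial.derivative (restrictLine x v f) =
      ∑ i, Polynomial.C (v i) * restrictLine x v (pderiv i f) := by
  classical
  induction f using MvPolynomial.induction_on with
  | C a => simp [restrictLine]
  | add p q hp hq => simp [hp, hq, mul_add, Finset.sum_add_distrib]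
  | mul_X p j hp =>
    have hX : restrictLine x v (X j) = Polynomial.C (x j) + Polynomial.C (v j) * Polynomial.X := by
      simp [restrictLine]
    simp only [Derivation.leibniz, map_add, smul_eq_mul, map_mul, Polynomial.derivative_mul, hp,
      mul_add, Finset.sum_add_distrib, pderiv_X]
    have hs : ∀ i, restrictLine x v (Pi.single (M := fun _ => MvPolynomial σ ℂ) i 1 j) =
        if j = i then 1 else 0 := fun i => by
      by_cases h : j = i
      · subst h; simp
      · simp [h]
    simp only [hs, mul_ite, mul_one, mul_zero, Finset.sum_ite_eq, Finset.mem_univ, if_true, hX,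
      Finset.sum_mul]
    rw [add_comm]
    congr 1
    · rw [Polynomial.derivative_add, Polynomial.derivative_C, zero_add, Polynomial.derivative_mul]
      simp only [Polynomial.derivative_C, Polynomial.derivative_X]
      ring
    · exact Finset.sum_congr rfl fun i _ => by ring

theorem eq_of_eval_eq_of_eval_ne_zero [Finite σ] {q f g : MvPolynomial σ ℂ} (hq : q ≠ 0)
    (h : ∀ x, eval x q ≠ 0 → eval x f = eval x g) : f = g := by
  have : q * (f - g) = 0 := by
    apply MvPolynomial.funext
    intro x
    by_cases hx : eval x q = 0
    · simp [hx]
    · simp [h x hx]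
  exact sub_eq_zero.1 ((mul_eq_zero.1 this).resolve_left hq)

theorem exists_eval_ne_zero [Finite σ] {q : MvPolynomial σ ℂ} (hq : q ≠ 0) : ∃ x, eval x q ≠ 0 := by
  by_contra! h
  exact hq (MvPolynomial.funext fun x => by simp [h x])

theorem aeval_smul_of_isHomogeneous {K : Type*} [CommRing K] [Algebra ℂ K]
    {F : MvPolynomial σ ℂ} {m : ℕ} (hF : F.IsHomogeneous m) (c : K) (x : σ → K) :
    aeval (c • x) F = c ^ m * aeval x F := by
  rw [aeval_def, aeval_def, eval₂_eq, eval₂_eq, Finset.mul_sum]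
  refine Finset.sum_congr rfl fun d hd => ?_
  simp only [Pi.smul_apply, smul_eq_mul, mul_pow, Finset.prod_mul_distrib,
    Finset.prod_pow_eq_pow_sum]
  rw [← hF.degree_eq_sum_deg_support hd]
  ring

theorem eval_smul_of_isHomogeneous {f : MvPolynomial σ ℂ} {d : ℕ} (hf : f.IsHomogeneous d)
    (c : ℂ) (x : σ → ℂ) : eval (c • x) f = c ^ d * eval x f := by
  simpa only [aeval_eq_eval] using aeval_smul_of_isHomogeneous hf c x

end Line

/-! ### Factors of homogeneous polynomials. -/

section Scaling

variable {σ R : Type*} [CommRing R]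

/-- The substitution `x ↦ T x`. -/
noncomputable def scaleHom : MvPolynomial σ R →ₐ[R] Polynomial (MvPolynomial σ R) :=
  aeval fun i => Polynomial.C (X i) * Polynomial.X

theorem scaleHom_monomial (m : σ →₀ ℕ) (r : R) :
    scaleHom (monomial m r) = Polynomial.monomial m.degree (monomial m r) := by
  rw [scaleHom, aeval_monomial]
  rw [← Polynomial.C_mul_X_pow_eq_monomial, MvPolynomial.monomial_eq, Finsupp.degree_apply]
  simp only [Polynomial.C_mul]
  rw [Finsupp.prod, Finsupp.prod, map_prod Polynomial.C]
  simp [mul_pow, Finset.prod_mul_distrib, Finset.prod_pow_eq_pow_sum,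
    IsScalarTower.algebraMap_apply R (MvPolynomial σ R) (Polynomial _), algebraMap_eq, mul_assoc]

theorem coeff_scaleHom (f : MvPolynomial σ R) (k : ℕ) :
    (scaleHom f).coeff k = homogeneousComponent k f := by
  induction f using MvPolynomial.induction_on' with
  | monomial m r =>
    rw [scaleHom_monomial, Polynomial.coeff_monomial,
      homogeneousComponent_of_mem (isHomogeneous_monomial r rfl)]
    simp [eq_comm]
  | add p q hp hq => simp [hp, hq]

theorem isHomogeneous_iff_scaleHom {f : MvPolynomial σ R} {d : ℕ} :
    f.IsHomogeneous d ↔ scaleHom f = Polynomial.monomial d f := by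
  constructor
  · intro h
    ext1 k
    rw [coeff_scaleHom, homogeneousComponent_of_mem h, Polynomial.coeff_monomial]
    simp [eq_comm]
  · intro h
    have := coeff_scaleHom f d
    rw [h, Polynomial.coeff_monomial, if_pos rfl] at this
    rw [this]
    exact homogeneousComponent_isHomogeneous d f

/-- Over a domain, both the highest and the lowest degree are additive under multiplication. They
coincide for the product, hence for each factor. -/
theorem isHomogeneous_left_of_mul [IsDomain R] {a b : MvPolynomial σ R} {d : ℕ} (hab : a * b ≠ 0)
    (h : (a * b).IsHomogeneous d) : ∃ e, a.IsHomogeneous e := by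
  rw [isHomogeneous_iff_scaleHom, map_mul] at h
  have h0 : Polynomial.monomial d (a * b) ≠ 0 := by simpa using hab
  have ha : scaleHom a ≠ 0 := fun h' => h0 (by rw [← h, h', zero_mul])
  have hb : scaleHom b ≠ 0 := fun h' => h0 (by rw [← h, h', mul_zero])
  have h1 := Polynomial.natDegree_mul ha hb
  have h2 := Polynomial.natTrailingDegree_mul ha hb
  rw [h, Polynomial.natDegree_monomial_eq _ hab] at h1
  rw [h, Polynomial.natTrailingDegree_monomial hab] at h2
  have h3 := Polynomial.natTrailingDegree_le_natDegree (scaleHom a)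
  have h4 := Polynomial.natTrailingDegree_le_natDegree (scaleHom b)
  refine ⟨(scaleHom a).natDegree, ?_⟩
  have key : ∀ k, k ≠ (scaleHom a).natDegree → homogeneousComponent k a = 0 := by
    intro k hk
    rw [← coeff_scaleHom]
    rcases lt_or_gt_of_ne hk with hk | hk
    · exact Polynomial.coeff_eq_zero_of_lt_natTrailingDegree (by omega)
    · exact Polynomial.coeff_eq_zero_of_natDegree_lt hk
  intro m hm
  by_contra hne
  have := congrArg (coeff m) (key (Finsupp.weight 1 m) hne)
  rw [coeff_homogeneousComponent, if_pos (by rw [Finsupp.degree_eq_weight_one]; rfl)] at this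
  exact hm (by simpa using this)

theorem isHomogeneous_of_dvd [IsDomain R] {a f : MvPolynomial σ R} {d : ℕ} (hf : f ≠ 0)
    (h : f.IsHomogeneous d) (ha : a ∣ f) : ∃ e, a.IsHomogeneous e := by
  obtain ⟨b, rfl⟩ := ha
  exact isHomogeneous_left_of_mul hf h

end Scaling

/-! ### Invariance along the lines `x + t H(x)`. -/

section Invariant

variable {n : ℕ}

/-- The polynomial `f` is constant on the lines `x + t H(x)`. -/
def IsConstAlong (H : PolyMap ℂ n n) (f : MvPolynomial (Fin n) ℂ) : Prop :=
  ∀ (x : Fin n → ℂ) (t : ℂ), eval (x + t • H.toFun x) f = eval x f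

theorem eval_bind_shift (H : PolyMap ℂ n n) (t : ℂ) (x : Fin n → ℂ) (f : MvPolynomial (Fin n) ℂ) :
    eval x (bind₁ (fun i => X i + C t * H i) f) = eval (x + t • H.toFun x) f := by
  induction f using MvPolynomial.induction_on with
  | C a => simp
  | add p q hp hq => simp [hp, hq]
  | mul_X p i hp => simp [hp, PolyMap.toFun]

/-- The identity says `H(x + H(x)) = H(x)`. Iterating gives invariance for all natural `t`, and a
polynomial in `t` that is constant on infinitely many values is constant. -/
theorem isConstAlong_of_isQuasiTranslation {H : PolyMap ℂ n n} (hH : H.IsQuasiTranslation)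
    (i : Fin n) : IsConstAlong H (H i) := by
  have h1 : ∀ x i, eval (x + H.toFun x) (H i) = eval x (H i) := by
    intro x i
    have hs : PolyMap.id ℂ n + H = fun i => X i + C 1 * H i := by
      funext i
      rw [map_one, one_mul]
      rfl
    have h : eval x (bind₁ (PolyMap.id ℂ n + H) (X i - H i)) = eval x (X i) :=
      congrArg (eval x) (congrFun hH i)
    rw [hs, eval_bind_shift, one_smul, map_sub, eval_X, eval_X] at h
    simp only [Pi.add_apply] at h
    change x i + eval x (H i) - _ = _ at h
    linear_combination -h
  have hN : ∀ (m : ℕ) x i, eval (x + (m : ℂ) • H.toFun x) (H i) = eval x (H i) := by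
    intro m
    induction m with
    | zero => simp
    | succ m ih =>
      intro x i
      have h2 := h1 (x + (m : ℂ) • H.toFun x) i
      have h3 : H.toFun (x + (m : ℂ) • H.toFun x) = H.toFun x := funext fun j => ih x j
      rw [h3, ih] at h2
      rw [← h2]
      congr 2
      push_cast
      module
  intro x t
  have h : restrictLine x (H.toFun x) (H i) = Polynomial.C (eval x (H i)) := by
    apply Polynomial.eq_of_infinite_eval_eq
    refine (Set.infinite_range_of_injective (Nat.cast_injective (R := ℂ))).mono ?_
    rintro _ ⟨m, rfl⟩
    simp [eval_restrictLine, hN]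
  rw [← eval_restrictLine, h, Polynomial.eval_C]

/-- On a line through a point where `f ≠ 0`, the factors restrict to polynomials in `T` whose
product is a nonzero constant, so each is constant. Density of such points does the rest. -/
theorem IsConstAlong.of_dvd {H : PolyMap ℂ n n} {f a : MvPolynomial (Fin n) ℂ} (hf : f ≠ 0)
    (h : IsConstAlong H f) (ha : a ∣ f) : IsConstAlong H a := by
  obtain ⟨b, rfl⟩ := ha
  intro x t
  rw [← eval_bind_shift]
  congr 1
  refine eq_of_eval_eq_of_eval_ne_zero hf fun x hx => ?_
  rw [eval_bind_shift]
  have hc : restrictLine x (H.toFun x) a * restrictLine x (H.toFun x) b =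
      Polynomial.C (eval x (a * b)) := by
    rw [← map_mul]
    apply Polynomial.funext
    intro s
    rw [eval_restrictLine, h, Polynomial.eval_C]
  have hu : IsUnit (restrictLine x (H.toFun x) a) :=
    isUnit_of_mul_isUnit_left (hc ▸ Polynomial.isUnit_C.2 hx.isUnit)
  obtain ⟨c, -, hc⟩ := Polynomial.isUnit_iff.1 hu
  have h0 := eval_restrictLine x (H.toFun x) a 0
  rw [← eval_restrictLine, ← hc]
  rw [← hc] at h0
  simpa using h0

theorem IsConstAlong.of_eq_mul {H G : PolyMap ℂ n n} {g f : MvPolynomial (Fin n) ℂ} (hg : g ≠ 0)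
    (hHG : ∀ i, H i = g * G i) (h : IsConstAlong H f) : IsConstAlong G f := by
  intro x t
  rw [← eval_bind_shift]
  congr 1
  -- Where `g ≠ 0` both maps define the same line, with time rescaled by `g(x)`.
  refine eq_of_eval_eq_of_eval_ne_zero hg fun x hx => ?_
  rw [eval_bind_shift, ← h x (t / eval x g)]
  congr 2
  ext i
  simp only [PolyMap.toFun, Pi.add_apply, Pi.smul_apply, smul_eq_mul, hHG, map_mul]
  field_simp

theorem IsConstAlong.sum_mul_pderiv {H : PolyMap ℂ n n} {f : MvPolynomial (Fin n) ℂ}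
    (h : IsConstAlong H f) : ∑ i, H i * pderiv i f = 0 := by
  apply MvPolynomial.funext
  intro x
  have hc : restrictLine x (H.toFun x) f = Polynomial.C (eval x f) := by
    apply Polynomial.funext
    intro s
    rw [eval_restrictLine, h, Polynomial.eval_C]
  have hd := congrArg (Polynomial.eval 0) (derivative_restrictLine x (H.toFun x) f)
  rw [hc, Polynomial.derivative_C, Polynomial.eval_finsetSum] at hd
  simp only [Polynomial.eval_mul, Polynomial.eval_C, eval_restrictLine, zero_smul, add_zero,
    Polynomial.eval_zero] at hd
  rw [map_zero, map_sum, hd]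
  simp [PolyMap.toFun]

/-- For `s ≠ 0`, homogeneity and invariance give `G(G(x) + s x) = s ^ e G(x + s⁻¹ G(x)) = s ^ e
G(x)`; then set `s = 0`. The extra factor `X` in `key` makes the identity trivial at `s = 0` until
it is cancelled. -/
theorem bind_self_eq_zero {G : PolyMap ℂ n n} {e : ℕ} (he : e ≠ 0)
    (hG : ∀ i, (G i).IsHomogeneous e) (h : ∀ i, IsConstAlong G (G i)) (i : Fin n)
    (x : Fin n → ℂ) : eval (G.toFun x) (G i) = 0 := by
  have key : Polynomial.X * restrictLine (G.toFun x) x (G i) =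
      Polynomial.X * (Polynomial.C (eval x (G i)) * Polynomial.X ^ e) := by
    apply Polynomial.funext
    intro s
    by_cases hs : s = 0
    · simp [hs]
    · have : G.toFun x + s • x = s • (x + s⁻¹ • G.toFun x) := by
        rw [smul_add, smul_smul, mul_inv_cancel₀ hs, one_smul, add_comm]
      simp only [Polynomial.eval_mul, eval_restrictLine, this, Polynomial.eval_X,
        eval_smul_of_isHomogeneous (hG i), h i x, Polynomial.eval_C, Polynomial.eval_pow]
      ring
  have h0 := congrArg (Polynomial.eval 0) (mul_left_cancel₀ Polynomial.X_ne_zero key)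
  simpa [eval_restrictLine, he] using h0

end Invariant

/-! ### Algebraic dependence of the components. -/

section Dependence

/-- By Gauss's lemma `g` stays irreducible over the fraction field, so it is the minimal polynomial
of `θ` up to a unit; primitivity brings divisibility back to `R`. -/
theorem Polynomial.dvd_of_irreducible_of_eval₂_eq_zero {R L : Type*} [CommRing R] [IsDomain R]
    [UniqueFactorizationMonoid R] [Field L] {φ : R →+* L} (hinj : Function.Injective φ) {θ : L}
    {g f : Polynomial R} (hg : Irreducible g) (hgθ : g.eval₂ φ θ = 0) (hf : f.eval₂ φ θ = 0) :
    g ∣ f := by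
  let : Algebra (FractionRing R) L := (IsFractionRing.lift hinj).toAlgebra
  have hd : g.natDegree ≠ 0 := by
    intro h0
    rw [Polynomial.eq_C_of_natDegree_eq_zero h0, Polynomial.eval₂_C] at hgθ
    have h1 := (map_eq_zero_iff _ hinj).1 hgθ
    rw [Polynomial.eq_C_of_natDegree_eq_zero h0, h1, Polynomial.C_0] at hg
    exact hg.ne_zero rfl
  have hp := hg.isPrimitive hd
  have hi := (hp.irreducible_iff_irreducible_map_fraction_map (K := FractionRing R)).1 hg
  have hz : ∀ p : Polynomial R, p.eval₂ φ θ = 0 →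
      Polynomial.aeval θ (p.map (algebraMap R (FractionRing R))) = 0 := fun p hp => by
    rw [Polynomial.aeval_def, Polynomial.eval₂_map, ← hp]
    congr 1
    ext r
    exact IsFractionRing.lift_algebraMap hinj r
  have hm := minpoly.eq_of_irreducible hi (hz g hgθ)
  have hdvd := minpoly.dvd (FractionRing R) θ (hz f hf)
  rw [← hm] at hdvd
  exact hp.dvd_of_fraction_map_dvd_fraction_map (K := FractionRing R)
    ((dvd_mul_right _ _).trans hdvd)

/-- If the components other than `G l` were independent, a prime element `g` of the relation ideal,
read as a polynomial in `X l`, would divide every relation. Each `G i` is a relation, contradicting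
coprimality. -/
theorem not_algebraicIndependent_of_bind_self_eq_zero {n : ℕ} {G : PolyMap ℂ n n}
    (h0 : ∃ i, G i ≠ 0) (hgcd : ∀ p, (∀ i, p ∣ G i) → IsUnit p)
    (hG : ∀ i, aeval G (G i) = 0) (l : Fin n) :
    ¬ AlgebraicIndependent ℂ fun j : {j // j ≠ l} => G j := by
  intro hind
  obtain ⟨i₀, hi₀⟩ := h0
  let I := RingHom.ker (aeval G : MvPolynomial (Fin n) ℂ →ₐ[ℂ] MvPolynomial (Fin n) ℂ)
  have hI : I.IsPrime := RingHom.ker_isPrime _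
  have hb : I ≠ ⊥ := fun h => hi₀ (by simpa [h] using (show G i₀ ∈ I from hG i₀))
  obtain ⟨g, hgI, hg⟩ := hI.exists_mem_prime_of_ne_bot hb
  let L := FractionRing (MvPolynomial (Fin n) ℂ)
  let φ : MvPolynomial {j // j ≠ l} ℂ →+* L :=
    (algebraMap (MvPolynomial (Fin n) ℂ) L).comp
      (aeval fun j : {j // j ≠ l} => G j : _ →ₐ[ℂ] MvPolynomial (Fin n) ℂ).toRingHom
  have hinj : Function.Injective φ :=
    (IsFractionRing.injective (MvPolynomial (Fin n) ℂ) L).comp hind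
  let E : MvPolynomial (Fin n) ℂ ≃ₐ[ℂ] Polynomial (MvPolynomial {j // j ≠ l} ℂ) :=
    (renameEquiv ℂ (Equiv.optionSubtypeNe l).symm).trans (optionEquivLeft ℂ _)
  have hE : ∀ f, (E f).eval₂ φ (algebraMap (MvPolynomial (Fin n) ℂ) L (G l)) =
      algebraMap _ L (aeval G f) := by
    intro f
    induction f using MvPolynomial.induction_on with
    | C a =>
      have h1 : E (C a) = Polynomial.C (C a) := by simp [E]
      rw [h1, Polynomial.eval₂_C]
      simp only [φ, RingHom.comp_apply, AlgHom.toRingHom_eq_coe, RingHom.coe_coe, aeval_C]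
    | add p q hp hq => rw [map_add, Polynomial.eval₂_add, hp, hq, map_add, map_add]
    | mul_X p i hp =>
      suffices hX : (E (X i)).eval₂ φ (algebraMap (MvPolynomial (Fin n) ℂ) L (G l)) =
          algebraMap (MvPolynomial (Fin n) ℂ) L (G i) by
        rw [map_mul, Polynomial.eval₂_mul, hp, map_mul, map_mul, aeval_X, hX]
      by_cases hi : i = l
      · have h1 : E (X i) = Polynomial.X := by simp [E, hi]
        rw [h1, Polynomial.eval₂_X, hi]
      · have h1 : E (X i) = Polynomial.C (X ⟨i, hi⟩) := by
          simp [E, Equiv.optionSubtypeNe_symm_of_ne hi]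
        rw [h1, Polynomial.eval₂_C]
        simp only [φ, RingHom.comp_apply, AlgHom.toRingHom_eq_coe, RingHom.coe_coe, aeval_X]
  refine hg.not_isUnit (hgcd g fun i => ?_)
  have h1 : E g ∣ E (G i) := by
    refine Polynomial.dvd_of_irreducible_of_eval₂_eq_zero hinj
      ((MulEquiv.irreducible_iff E).2 hg.irreducible)
      (θ := algebraMap (MvPolynomial (Fin n) ℂ) L (G l)) ?_ ?_
    · rw [hE, show aeval G g = 0 from hgI, map_zero]
    · rw [hE, hG, map_zero]
  simpa using map_dvd E.symm h1

end Dependence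

/-! ### Homogeneous relations and constant ratios. -/

section Ratio

theorem exists_isHomogeneous_aeval_eq_zero {ι σ : Type*} {v : ι → MvPolynomial σ ℂ} {e : ℕ}
    (he : e ≠ 0) (hv : ∀ i, (v i).IsHomogeneous e) (h : ¬ AlgebraicIndependent ℂ v) :
    ∃ (F : MvPolynomial ι ℂ) (m : ℕ), F ≠ 0 ∧ F.IsHomogeneous m ∧ aeval v F = 0 := by
  rw [algebraicIndependent_iff] at h
  push Not at h
  obtain ⟨F, hF, hF0⟩ := h
  obtain ⟨m, hm⟩ : ∃ m, homogeneousComponent m F ≠ 0 := by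
    by_contra! hc
    exact hF0 (by rw [← sum_homogeneousComponent F]; exact Finset.sum_eq_zero fun i _ => hc i)
  refine ⟨homogeneousComponent m F, m, hm, homogeneousComponent_isHomogeneous m F, ?_⟩
  -- Since `e ≠ 0`, components of different degrees land in different degrees `e * k`, so each one
  -- is a relation by itself.
  have hcomp : ∀ k, (aeval v (homogeneousComponent k F)).IsHomogeneous (e * k) := fun k =>
    (homogeneousComponent_isHomogeneous k F).aeval v hv
  have hmem : m ∈ Finset.range (F.totalDegree + 1) := by
    by_contra hc
    exact hm (homogeneousComponent_eq_zero _ _ (by simpa using hc))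
  have h1 := congrArg (fun p => homogeneousComponent (e * m) (aeval v p))
    (sum_homogeneousComponent F)
  simp only [map_sum, hF, map_zero] at h1
  rw [Finset.sum_eq_single_of_mem m hmem, homogeneousComponent_of_mem (hcomp m), if_pos rfl] at h1
  · exact h1
  · intro k _ hk
    rw [homogeneousComponent_of_mem (hcomp k), if_neg]
    exact fun h => hk (Nat.eq_of_mul_eq_mul_left (Nat.pos_of_ne_zero he) h).symm

/-- The dehomogenization `F(1, s, T)` as a polynomial in `T` over `ℂ[s]`. -/
noncomputable def dehomogenize : MvPolynomial (Fin 3) ℂ →ₐ[ℂ] Polynomial (Polynomial ℂ) :=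
  aeval ![1, Polynomial.C Polynomial.X, Polynomial.X]

theorem eval_map_dehomogenize {K : Type*} [Field K] [Algebra ℂ K] (c : ℂ) (θ : K)
    (F : MvPolynomial (Fin 3) ℂ) :
    Polynomial.aeval θ ((dehomogenize F).map (Polynomial.evalRingHom c)) =
      aeval ![1, algebraMap ℂ K c, θ] F := by
  induction F using MvPolynomial.induction_on with
  | C a => simp [dehomogenize, IsScalarTower.algebraMap_apply ℂ (Polynomial ℂ) (Polynomial _)]
  | add p q hp hq => simp [hp, hq]
  | mul_X p i hp =>
    rw [map_mul, Polynomial.map_mul, map_mul, hp, map_mul]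
    fin_cases i <;> simp [dehomogenize]

theorem aeval_one_eq_zero_of_isHomogeneous {K : Type*} [Field K] [Algebra ℂ K]
    {F : MvPolynomial (Fin 3) ℂ} {m : ℕ} (hF : F.IsHomogeneous m) {u v w : K} (hu : u ≠ 0)
    (h : aeval ![u, v, w] F = 0) : aeval ![1, v / u, w / u] F = 0 := by
  have : ![u, v, w] = u • ![1, v / u, w / u] := by
    ext i
    fin_cases i <;> simp [mul_div_cancel₀, hu]
  rw [this, aeval_smul_of_isHomogeneous hF] at h
  exact (mul_eq_zero.1 h).resolve_left (pow_ne_zero _ hu)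

theorem dehomogenize_ne_zero {F : MvPolynomial (Fin 3) ℂ} {m : ℕ} (hF : F.IsHomogeneous m)
    (h0 : F ≠ 0) : dehomogenize F ≠ 0 := by
  intro h
  apply h0
  refine eq_of_eval_eq_of_eval_ne_zero (X_ne_zero (0 : Fin 3)) fun x hx => ?_
  rw [eval_X] at hx
  have h1 := eval_map_dehomogenize (x 1 / x 0) (x 2 / x 0) F
  have h2 : x = x 0 • ![1, x 1 / x 0, x 2 / x 0] := by
    ext i
    fin_cases i <;> simp [mul_div_cancel₀, hx]
  rw [h, Polynomial.map_zero, map_zero] at h1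
  rw [h2, eval_smul_of_isHomogeneous hF, map_zero]
  simpa using Or.inr h1.symm

theorem mem_range_algebraMap_of_aeval_eq_zero {K : Type*} [Field K] [Algebra ℂ K]
    {q : Polynomial ℂ} (hq : q ≠ 0) {θ : K} (h : Polynomial.aeval θ q = 0) :
    ∃ r : ℂ, algebraMap ℂ K r = θ := by
  have hint : IsIntegral ℂ θ := IsAlgebraic.isIntegral ⟨q, hq, h⟩
  have := IsAlgClosed.degree_eq_one_of_irreducible ℂ (minpoly.irreducible hint)
  exact minpoly.mem_range_of_degree_eq_one ℂ θ this

/-- A nontrivial homogeneous relation `F(α, c α, κ) = 0` in a domain forces `κ` to be a scalar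
multiple of `α`, for all but finitely many scalars `c`. -/
theorem exists_finset_forall_eq_smul {F : MvPolynomial (Fin 3) ℂ} {m : ℕ}
    (hF : F.IsHomogeneous m) (h0 : F ≠ 0) :
    ∃ S : Finset ℂ, ∀ c ∉ S, ∀ (R : Type) [CommRing R] [IsDomain R] [Algebra ℂ R] (α κ : R),
      α ≠ 0 → aeval ![α, c • α, κ] F = 0 → ∃ r : ℂ, κ = r • α := by
  obtain ⟨r, hr⟩ : ∃ r, (dehomogenize F).coeff r ≠ 0 := by
    by_contra! hc
    exact dehomogenize_ne_zero hF h0 (Polynomial.ext hc)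
  -- Away from the roots of one nonzero coefficient, `F(1, c, T)` is a nonzero polynomial over `ℂ`.
  -- It kills `κ / α`, which is thus algebraic over `ℂ` and so a scalar.
  refine ⟨((dehomogenize F).coeff r).roots.toFinset, fun c hc R _ _ _ α κ hα h => ?_⟩
  have hq : (dehomogenize F).map (Polynomial.evalRingHom c) ≠ 0 := by
    intro hz
    have := congrArg (fun p => Polynomial.coeff p r) hz
    simp only [Polynomial.coeff_map, Polynomial.coe_evalRingHom, Polynomial.coeff_zero] at this
    exact hc (by simpa [hr] using this)
  have hinj := IsFractionRing.injective R (FractionRing R)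
  have hα' : algebraMap R (FractionRing R) α ≠ 0 := by
    rwa [Ne, map_eq_zero_iff _ hinj]
  have h1 : aeval ![algebraMap R (FractionRing R) α, algebraMap R (FractionRing R) (c • α),
      algebraMap R (FractionRing R) κ] F = 0 := by
    have := congrArg (algebraMap R (FractionRing R)) h
    rw [map_zero, ← aeval_algebraMap_apply] at this
    rw [← this]
    congr 2
    ext i
    fin_cases i <;> rfl
  have h2 := aeval_one_eq_zero_of_isHomogeneous hF hα' h1
  have h3 : algebraMap R (FractionRing R) (c • α) / algebraMap R (FractionRing R) α =
      algebraMap ℂ (FractionRing R) c := by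
    rw [Algebra.smul_def, map_mul, mul_div_cancel_right₀ _ hα',
      ← IsScalarTower.algebraMap_apply]
  rw [h3, ← eval_map_dehomogenize] at h2
  obtain ⟨s, hs⟩ := mem_range_algebraMap_of_aeval_eq_zero hq h2
  refine ⟨s, hinj ?_⟩
  rw [eq_div_iff hα'] at hs
  rw [← hs, Algebra.smul_def, map_mul, ← IsScalarTower.algebraMap_apply]

end Ratio

theorem not_algebraicIndependent_triple {n : ℕ} (hn : n ≤ 4) {G : PolyMap ℂ n n}
    (h0 : ∃ i, G i ≠ 0) (hgcd : ∀ p, (∀ i, p ∣ G i) → IsUnit p)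
    (hG : ∀ i, aeval G (G i) = 0) {a b k : Fin n} (hab : a ≠ b) (hak : a ≠ k) (hbk : b ≠ k) :
    ¬ AlgebraicIndependent ℂ ![G a, G b, G k] := by
  intro hind
  obtain ⟨l, hl⟩ : ∃ l : Fin n, ∀ j, j ≠ l → j = a ∨ j = b ∨ j = k := by
    by_contra! hc
    obtain ⟨j, -, hj⟩ := hc a
    obtain ⟨i, hi, hj'⟩ := hc j
    have : ({a, b, k, i, j} : Finset (Fin n)).card = 5 := by
      rw [Finset.card_insert_of_notMem, Finset.card_insert_of_notMem,
        Finset.card_insert_of_notMem, Finset.card_insert_of_notMem, Finset.card_singleton] <;>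
        simp <;> grind
    have h2 := Finset.card_le_univ ({a, b, k, i, j} : Finset (Fin n))
    rw [this, Fintype.card_fin] at h2
    omega
  refine not_algebraicIndependent_of_bind_self_eq_zero h0 hgcd hG l ?_
  have hex : ∀ j : {j // j ≠ l}, ∃ s : Fin 3, ![a, b, k] s = j := by
    rintro ⟨j, hj⟩
    rcases hl j hj with rfl | rfl | rfl
    exacts [⟨0, rfl⟩, ⟨1, rfl⟩, ⟨2, rfl⟩]
  choose s hs using hex
  have hsinj : Function.Injective s := fun i j hij => Subtype.ext (by rw [← hs i, ← hs j, hij])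
  convert hind.comp s hsinj using 1
  ext1 j
  rw [Function.comp_apply, ← hs j]
  generalize s j = t
  fin_cases t <;> rfl

/-! ### Hyperplanes and linear factors. -/

section LinearForm

variable {σ : Type*} [Fintype σ]

/-- A polynomial vanishing on the hyperplane `z = 0` is divisible by the linear form `z`. -/
theorem linearForm_dvd {z : σ → ℂ} {k : σ} (hk : z k ≠ 0) {f : MvPolynomial σ ℂ}
    (h : ∀ x : σ → ℂ, ∑ i, z i * x i = 0 → eval x f = 0) : ∑ i, C (z i) * X i ∣ f := by
  classical
  set ℓ : MvPolynomial σ ℂ := ∑ i, C (z i) * X i with hℓ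
  -- This substitution projects onto the hyperplane along the `k`-th axis, so it kills `f`; modulo
  -- `ℓ` it is the identity.
  let s : σ → MvPolynomial σ ℂ := fun i => X i - C (if i = k then (z k)⁻¹ else 0) * ℓ
  have h1 : bind₁ s f = 0 := by
    apply MvPolynomial.funext
    intro x
    have h2 : eval x (bind₁ s f) = eval (fun i => eval x (s i)) f := eval₂Hom_bind₁ _ _ _ _
    rw [h2, map_zero]
    apply h
    simp [s, hℓ, mul_sub, Finset.sum_sub_distrib]
    field_simp
    simp
  have h3 : (Ideal.Quotient.mkₐ ℂ (Ideal.span {ℓ})).comp (bind₁ s) =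
      Ideal.Quotient.mkₐ ℂ (Ideal.span {ℓ}) := by
    ext i
    have : Ideal.Quotient.mk (Ideal.span {ℓ}) ℓ = 0 :=
      Ideal.Quotient.eq_zero_iff_mem.2 (Ideal.mem_span_singleton_self ℓ)
    simp [s, this]
  have h4 := congrArg (fun g => g f) h3
  simp only [AlgHom.comp_apply, h1, map_zero] at h4
  exact Ideal.mem_span_singleton.1 (Ideal.Quotient.eq_zero_iff_mem.1 h4.symm)

/-- A subspace of codimension at most one contains a hyperplane given by a nonzero linear form. -/
theorem exists_linearForm_of_card_le {n : ℕ} (hn : 1 ≤ n) (U : Submodule ℂ (Fin n → ℂ))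
    (hU : n ≤ Module.finrank ℂ U + 1) :
    ∃ (z : Fin n → ℂ) (k : Fin n), z k ≠ 0 ∧ ∀ x : Fin n → ℂ, ∑ i, z i * x i = 0 → x ∈ U := by
  by_cases h : U = ⊤
  · exact ⟨fun _ => 1, ⟨0, hn⟩, one_ne_zero, by simp [h]⟩
  obtain ⟨f, hf0, hf⟩ := Submodule.exists_le_ker_of_lt_top U (lt_top_iff_ne_top.2 h)
  have hfx : ∀ x, f x = ∑ i, f (Pi.single i 1) * x i := by
    intro x
    conv_lhs => rw [pi_eq_sum_univ' x]
    simp [mul_comm]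
  obtain ⟨k, hk⟩ : ∃ k, f (Pi.single k 1) ≠ 0 := by
    by_contra! hc
    exact hf0 (LinearMap.ext fun x => by simp [hfx x, hc])
  refine ⟨fun i => f (Pi.single i 1), k, hk, fun x hx => ?_⟩
  have := Submodule.finrank_lt (s := LinearMap.ker f) fun h => hf0 (LinearMap.ker_eq_top.1 h)
  rw [Module.finrank_fin_fun] at this
  rw [Submodule.eq_of_le_of_finrank_le hf (by omega), LinearMap.mem_ker, hfx, hx]

end LinearForm

theorem exists_irreducible_dvd_eval_eq_zero {σ : Type*} {N : MvPolynomial σ ℂ} (h0 : N ≠ 0)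
    {y : σ → ℂ} (hy : eval y N = 0) : ∃ P, Irreducible P ∧ P ∣ N ∧ eval y P = 0 := by
  obtain ⟨f, hf, u, hu⟩ := UniqueFactorizationMonoid.exists_prime_factors N h0
  have h1 : eval y f.prod = 0 := by
    rw [← hu, map_mul] at hy
    exact (mul_eq_zero.1 hy).resolve_right (u.isUnit.map (eval y)).ne_zero
  rw [map_multiset_prod, Multiset.prod_eq_zero_iff, Multiset.mem_map] at h1
  obtain ⟨P, hP, hPy⟩ := h1
  exact ⟨P, (hf P hP).irreducible, (Multiset.dvd_prod hP).trans ⟨u, hu.symm⟩, hPy⟩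

/-! ### Hypersurfaces on which `G` has constant direction. -/

section Fiber

variable {n : ℕ} {G : PolyMap ℂ n n}

/-- `P` is an irreducible polynomial vanishing at `y`, and on its zero locus `G` is a multiple of
`G(y)`. -/
structure IsFiberFactor (G : PolyMap ℂ n n) (a : Fin n) (y : Fin n → ℂ)
    (P : MvPolynomial (Fin n) ℂ) : Prop where
  irreducible : Irreducible P
  eval_eq_zero : eval y P = 0
  dvd : ∀ i, P ∣ C (eval y (G a)) * G i - C (eval y (G i)) * G a

/-- Modulo `P` one has `G b = c • G a`, so outside finitely many `c` the homogeneous relation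
between `G a`, `G b`, `G k` makes `G k` a scalar multiple of `G a` too. Evaluation at `y` identifies
the scalar. -/
theorem exists_finset_dvd (hn : n ≤ 4) (h0 : ∃ i, G i ≠ 0) (hgcd : ∀ p, (∀ i, p ∣ G i) → IsUnit p)
    {e : ℕ} (he : e ≠ 0) (hhom : ∀ i, (G i).IsHomogeneous e) (hG : ∀ i, aeval G (G i) = 0)
    {a b : Fin n} (hab : a ≠ b) (k : Fin n) :
    ∃ S : Finset ℂ, ∀ c ∉ S, ∀ (y : Fin n → ℂ) (P : MvPolynomial (Fin n) ℂ), Irreducible P →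
      eval y P = 0 → eval y (G a) ≠ 0 → P ∣ G b - C c * G a →
      P ∣ C (eval y (G a)) * G k - C (eval y (G k)) * G a := by
  have hlin : ∀ (r : ℂ) (i : Fin n) (y : Fin n → ℂ) (P : MvPolynomial (Fin n) ℂ),
      eval y P = 0 → P ∣ G i - C r * G a →
      P ∣ C (eval y (G a)) * G i - C (eval y (G i)) * G a := by
    rintro r i y P hP ⟨w, hw⟩
    have h1 := congrArg (eval y) hw
    simp only [map_sub, map_mul, eval_C, hP, zero_mul] at h1
    refine ⟨C (eval y (G a)) * w, ?_⟩
    rw [sub_eq_zero.1 h1, map_mul]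
    linear_combination C (eval y (G a)) * hw
  by_cases hak : a = k
  · subst hak
    exact ⟨∅, fun c _ y P _ _ _ _ => by simp⟩
  by_cases hbk : b = k
  · subst hbk
    exact ⟨∅, fun c _ y P _ hP _ h => hlin c b y P hP h⟩
  obtain ⟨F, m, hF0, hF, hFG⟩ := exists_isHomogeneous_aeval_eq_zero he
    (v := ![G a, G b, G k]) (fun i => by fin_cases i <;> exact hhom _)
    (not_algebraicIndependent_triple hn h0 hgcd hG hab hak hbk)
  obtain ⟨S, hS⟩ := exists_finset_forall_eq_smul hF hF0
  refine ⟨S, fun c hc y P hP hPy ha hdvd => ?_⟩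
  have : (Ideal.span {P}).IsPrime := (Ideal.span_singleton_prime hP.ne_zero).2 hP.prime
  let π := Ideal.Quotient.mkₐ ℂ (Ideal.span {P})
  have hπ : ∀ f, π f = 0 ↔ P ∣ f := fun f =>
    Ideal.Quotient.eq_zero_iff_mem.trans Ideal.mem_span_singleton
  have hπb : π (G b) = c • π (G a) := by
    rw [← sub_eq_zero, ← map_smul, ← map_sub, hπ, smul_eq_C_mul]
    exact hdvd
  obtain ⟨r, hr⟩ := hS c hc (MvPolynomial (Fin n) ℂ ⧸ Ideal.span {P}) (π (G a)) (π (G k))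
    (by
      rw [Ne, hπ]
      rintro ⟨w, hw⟩
      exact ha (by rw [hw, map_mul, hPy, zero_mul]))
    (by
      rw [← hπb, ← map_zero π, ← hFG, comp_aeval_apply]
      congr 2
      ext i
      fin_cases i <;> rfl)
  refine hlin r k y P hPy ?_
  rw [← hπ, map_sub, hr, ← smul_eq_C_mul, map_smul, sub_self]

theorem exists_isFiberFactor (hn : n ≤ 4) (hgcd : ∀ p, (∀ i, p ∣ G i) → IsUnit p)
    {e : ℕ} (he : e ≠ 0) (hhom : ∀ i, (G i).IsHomogeneous e) (hG : ∀ i, aeval G (G i) = 0)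
    {a b : Fin n} (ha : G a ≠ 0) (hab : ∀ c, G b ≠ C c * G a) :
    ∃ B : MvPolynomial (Fin n) ℂ, B ≠ 0 ∧ ∀ y, eval y B ≠ 0 →
      eval y (G a) ≠ 0 ∧ ∃ P, IsFiberFactor G a y P := by
  have hne : a ≠ b := fun h => hab 1 (by simp [h])
  choose S hS using exists_finset_dvd hn ⟨a, ha⟩ hgcd he hhom hG hne
  let T := Finset.univ.biUnion S
  refine ⟨G a * ∏ ρ ∈ T, (G b - C ρ * G a), mul_ne_zero ha
    (Finset.prod_ne_zero_iff.2 fun ρ _ => sub_ne_zero.2 (hab ρ)), fun y hy => ?_⟩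
  rw [map_mul, map_prod] at hy
  have hya := left_ne_zero_of_mul hy
  have hyT := Finset.prod_ne_zero_iff.1 (right_ne_zero_of_mul hy)
  refine ⟨hya, ?_⟩
  let c := eval y (G b) / eval y (G a)
  have hN : eval y (G b - C c * G a) = 0 := by
    simp [c, hya]
  obtain ⟨P, hP, hPd, hPy⟩ := exists_irreducible_dvd_eval_eq_zero (sub_ne_zero.2 (hab c)) hN
  refine ⟨P, hP, hPy, fun k => hS k c (fun hc => ?_) y P hP hPy hya hPd⟩
  exact hyT c (Finset.mem_biUnion.2 ⟨k, Finset.mem_univ k, hc⟩) hN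

/-- Modulo `P` the vector `G(y)` is proportional to `G`, and the derivative of `Q` along `G` is
zero. The factor `G a` can be cancelled because `P` vanishes at `y` and `G a` does not. -/
theorem IsFiberFactor.dvd_sum_pderiv {a : Fin n} {y : Fin n → ℂ} {P Q : MvPolynomial (Fin n) ℂ}
    (hP : IsFiberFactor G a y P) (hy : eval y (G a) ≠ 0) (hQ : IsConstAlong G Q) :
    P ∣ ∑ i, C (eval y (G i)) * pderiv i Q := by
  have h1 : G a * ∑ i, C (eval y (G i)) * pderiv i Q =
      -∑ i, (C (eval y (G a)) * G i - C (eval y (G i)) * G a) * pderiv i Q := by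
    have h2 : ∑ i, (C (eval y (G a)) * G i - C (eval y (G i)) * G a) * pderiv i Q =
        C (eval y (G a)) * ∑ i, G i * pderiv i Q -
          G a * ∑ i, C (eval y (G i)) * pderiv i Q := by
      rw [Finset.mul_sum, Finset.mul_sum, ← Finset.sum_sub_distrib]
      exact Finset.sum_congr rfl fun i _ => by ring
    rw [h2, hQ.sum_mul_pderiv]
    ring
  have h3 : P ∣ G a * ∑ i, C (eval y (G i)) * pderiv i Q := by
    rw [h1, dvd_neg]
    exact Finset.dvd_sum fun i _ => (hP.dvd i).mul_right _
  refine (hP.irreducible.prime.dvd_or_dvd h3).resolve_left ?_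
  rintro ⟨w, hw⟩
  exact hy (by rw [hw, map_mul, hP.eval_eq_zero, zero_mul])

theorem sub_ne_zero_of_forall_ne {a b : Fin n} (hab : ∀ c, G b ≠ C c * G a) {y : Fin n → ℂ}
    (hy : eval y (G a) ≠ 0) : C (eval y (G a)) * G b - C (eval y (G b)) * G a ≠ 0 := by
  intro h
  apply hab (eval y (G b) / eval y (G a))
  have h1 : (C (eval y (G a)) : MvPolynomial (Fin n) ℂ) ≠ 0 := by simpa using hy
  apply mul_left_cancel₀ h1
  rw [sub_eq_zero.1 h, ← mul_assoc, ← C_mul, mul_div_cancel₀ _ hy]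

/-- Take `P` of least degree among all fiber factors at points with `B ≠ 0`. Its derivative along
`G(y')` is divisible by a fiber factor at `y'` yet has smaller degree, so it vanishes. By linearity
so do the derivatives along the span, and Euler's formula gives `P = 0` there. -/
theorem exists_isFiberFactor_vanishing_on_imageSpan {e : ℕ} (hhom : ∀ i, (G i).IsHomogeneous e)
    (hinv : ∀ i, IsConstAlong G (G i)) {a b : Fin n} (hab : ∀ c, G b ≠ C c * G a)
    {B : MvPolynomial (Fin n) ℂ} (hB0 : B ≠ 0)
    (hB : ∀ y, eval y B ≠ 0 → eval y (G a) ≠ 0 ∧ ∃ P, IsFiberFactor G a y P) :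
    ∃ y P, eval y B ≠ 0 ∧ IsFiberFactor G a y P ∧ ∀ c ∈ G.imageSpan, eval c P = 0 := by
  have hex : ∃ d y P, eval y B ≠ 0 ∧ IsFiberFactor G a y P ∧ P.totalDegree = d := by
    obtain ⟨y, hy⟩ := exists_eval_ne_zero hB0
    obtain ⟨-, P, hP⟩ := hB y hy
    exact ⟨_, y, P, hy, hP, rfl⟩
  classical
  obtain ⟨y, P, hy, hP, hd⟩ := Nat.find_spec hex
  have hmin : ∀ y' P', eval y' B ≠ 0 → IsFiberFactor G a y' P' →
      P.totalDegree ≤ P'.totalDegree := fun y' P' h1 h2 =>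
    hd.trans_le (Nat.find_min' hex ⟨y', P', h1, h2, rfl⟩)
  refine ⟨y, P, hy, hP, ?_⟩
  have hN := sub_ne_zero_of_forall_ne hab (hB y hy).1
  obtain ⟨d, hPd⟩ := isHomogeneous_of_dvd hN (((hhom b).C_mul _).sub ((hhom a).C_mul _)) (hP.dvd b)
  have hPinv : IsConstAlong G P := by
    refine IsConstAlong.of_dvd hN (fun x t => ?_) (hP.dvd b)
    simp only [map_sub, map_mul, eval_C, hinv a x t, hinv b x t]
  have hdeg : P.totalDegree = d := hPd.totalDegree hP.irreducible.ne_zero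
  have hd0 : d ≠ 0 := by
    rintro rfl
    rw [totalDegree_eq_zero_iff_eq_C] at hdeg
    have h1 := hP.eval_eq_zero
    rw [hdeg, eval_C] at h1
    exact hP.irreducible.ne_zero (by rw [hdeg, h1, C_0])
  have hder : ∀ y', eval y' B ≠ 0 → ∑ i, C (eval y' (G i)) * pderiv i P = 0 := by
    intro y' hy'
    obtain ⟨ha', P', hP'⟩ := hB y' hy'
    by_contra hne
    have h1 := totalDegree_le_of_dvd_of_isDomain (hP'.dvd_sum_pderiv ha' hPinv) hne
    have h2 : (∑ i, C (eval y' (G i)) * pderiv i P).IsHomogeneous (d - 1) :=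
      IsHomogeneous.sum _ _ _ fun i _ => hPd.pderiv.C_mul _
    rw [h2.totalDegree hne] at h1
    have h3 := hmin y' P' hy' hP'
    omega
  have hder' : ∀ x, ∀ c ∈ G.imageSpan, ∑ i, c i * eval x (pderiv i P) = 0 := by
    intro x
    have h1 : ∑ i, G i * C (eval x (pderiv i P)) = 0 := by
      refine eq_of_eval_eq_of_eval_ne_zero hB0 fun y' hy' => ?_
      have h2 := congrArg (eval x) (hder y' hy')
      simpa using h2
    intro c hc
    induction hc using Submodule.span_induction with
    | mem c hc =>
      obtain ⟨y', rfl⟩ := hc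
      simpa [PolyMap.toFun] using congrArg (eval y') h1
    | zero => simp
    | add u v _ _ hu hv => simp [add_mul, Finset.sum_add_distrib, hu, hv]
    | smul r u _ hu => simp [mul_assoc, ← Finset.mul_sum, hu]
  intro c hc
  have h1 := congrArg (eval c) hPd.sum_X_mul_pderiv
  simp only [map_sum, map_mul, eval_X, map_nsmul, hder' c c hc] at h1
  simpa [hd0] using h1.symm

end Fiber

/-! ### The dimension bounds, homogeneous and general. -/

section Main

variable {n : ℕ}

theorem finrank_imageSpan_le_one_of_parallel {G : PolyMap ℂ n n} {g : MvPolynomial (Fin n) ℂ}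
    {c : Fin n → ℂ} (h : ∀ i, G i = C (c i) * g) : Module.finrank ℂ G.imageSpan ≤ 1 := by
  have hle : G.imageSpan ≤ Submodule.span ℂ {c} := by
    refine Submodule.span_le.2 ?_
    rintro _ ⟨x, rfl⟩
    refine Submodule.mem_span_singleton.2 ⟨eval x g, ?_⟩
    ext i
    simp [PolyMap.toFun, h, mul_comm]
  exact (Submodule.finrank_mono hle).trans (by
    simpa using finrank_span_le_card (R := ℂ) {c})

theorem finrank_imageSpan_le_of_primitive (hn : n ≤ 4) {G : PolyMap ℂ n n} {e : ℕ}
    (hhom : ∀ i, (G i).IsHomogeneous e) (hinv : ∀ i, IsConstAlong G (G i))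
    (hgcd : ∀ p, (∀ i, p ∣ G i) → IsUnit p) :
    Module.finrank ℂ G.imageSpan ≤ max (n - 2) 1 := by
  obtain ⟨a, ha⟩ : ∃ a, G a ≠ 0 := by
    by_contra! hc
    exact not_isUnit_zero (hgcd 0 fun i => by rw [hc i])
  by_cases hpar : ∀ j, ∃ c : ℂ, G j = C c * G a
  · choose c hc using hpar
    exact (finrank_imageSpan_le_one_of_parallel hc).trans (le_max_right _ _)
  push Not at hpar
  obtain ⟨b, hab⟩ := hpar
  have he : e ≠ 0 := by
    rintro rfl
    have h1 : ∀ i, G i = C (coeff 0 (G i)) := fun i =>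
      totalDegree_eq_zero_iff_eq_C.1 (Nat.le_zero.1 (hhom i).totalDegree_le)
    apply hab (coeff 0 (G b) / coeff 0 (G a))
    have h2 : coeff 0 (G a) ≠ 0 := fun h => ha (by rw [h1 a, h, C_0])
    conv_rhs => rw [h1 a]
    rw [← C_mul, coeff_C, if_pos rfl, div_mul_cancel₀ _ h2]
    exact h1 b
  have hG : ∀ i, aeval G (G i) = 0 := fun i => by
    apply MvPolynomial.funext
    intro x
    rw [map_zero, ← bind_self_eq_zero he hhom hinv i x]
    exact eval₂Hom_bind₁ _ _ _ _
  obtain ⟨B, hB0, hB⟩ := exists_isFiberFactor hn hgcd he hhom hG ha hab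
  obtain ⟨y, P, hy, hP, hPs⟩ :=
    exists_isFiberFactor_vanishing_on_imageSpan hhom hinv hab hB0 hB
  -- The extra factor in `B` ensures that `G(y')` is not parallel to `G(y)`.
  obtain ⟨y', Q, hy', hQ, hQs⟩ :=
    exists_isFiberFactor_vanishing_on_imageSpan hhom hinv hab
      (mul_ne_zero hB0 (sub_ne_zero_of_forall_ne hab (hB y hy).1))
      fun y' h => hB y' (left_ne_zero_of_mul (by rwa [map_mul] at h))
  rw [map_mul] at hy'
  have hya := (hB y hy).1
  have hya' := (hB y' (left_ne_zero_of_mul hy')).1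
  have hM := right_ne_zero_of_mul hy'
  simp only [map_sub, map_mul, eval_C] at hM
  have hrel : ∀ c y P, eval c P = 0 → IsFiberFactor G a y P → ∀ i,
      eval y (G a) * eval c (G i) = eval y (G i) * eval c (G a) := by
    intro c y P hc hP i
    obtain ⟨w, hw⟩ := hP.dvd i
    have := congrArg (eval c) hw
    simp only [map_sub, map_mul, eval_C, hc, zero_mul] at this
    exact sub_eq_zero.1 this
  have hzero : ∀ c ∈ G.imageSpan, ∀ i, eval c (G i) = 0 := by
    intro c hc
    have h1 := hrel c y P (hPs c hc) hP
    have h2 := hrel c y' Q (hQs c hc) hQ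
    have h3 : eval c (G a) = 0 := by
      have h4 : (eval y (G a) * eval y' (G b) - eval y (G b) * eval y' (G a)) *
          eval c (G a) = 0 := by
        linear_combination eval y' (G a) * h1 b - eval y (G a) * h2 b
      exact (mul_eq_zero.1 h4).resolve_left hM
    intro i
    have h5 := h1 i
    rw [h3, mul_zero] at h5
    exact (mul_eq_zero.1 h5).resolve_left hya
  by_contra hlt
  rw [not_le] at hlt
  obtain ⟨z, k, hk, hz⟩ := exists_linearForm_of_card_le (Nat.lt_of_le_of_lt (Nat.zero_le _) a.isLt)
    G.imageSpan (by omega)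
  have hu := hgcd _ fun i => linearForm_dvd hk fun x hx => hzero x (hz x hx) i
  have h0 := (hu.map (eval (0 : Fin n → ℂ))).ne_zero
  simp at h0

theorem finrank_imageSpan_le_of_isHomogeneous (hn : n ≤ 4) {H : PolyMap ℂ n n} {d : ℕ}
    (hhom : ∀ i, (H i).IsHomogeneous d) (hinv : ∀ i, IsConstAlong H (H i)) :
    Module.finrank ℂ H.imageSpan ≤ max (n - 2) 1 := by
  by_cases hz : ∀ i, H i = 0
  · refine (finrank_imageSpan_le_one_of_parallel (c := 0) (g := 0) fun i => ?_).trans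
      (le_max_right _ _)
    simp [hz i]
  push Not at hz
  obtain ⟨i₀, hi₀⟩ := hz
  let : StrongNormalizationMonoid (MvPolynomial (Fin n) ℂ) :=
    UniqueFactorizationMonoid.strongNormalizationMonoid
  let : NormalizedGCDMonoid (MvPolynomial (Fin n) ℂ) :=
    UniqueFactorizationMonoid.toNormalizedGCDMonoid _
  obtain ⟨G, hHG, hG1⟩ := Finset.extract_gcd (s := Finset.univ) H ⟨i₀, Finset.mem_univ _⟩
  set g := Finset.univ.gcd H
  replace hHG : ∀ i, H i = g * G i := fun i => hHG i (Finset.mem_univ i)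
  have hgcd : ∀ p, (∀ i, p ∣ G i) → IsUnit p := fun p hp =>
    isUnit_of_dvd_one (hG1 ▸ Finset.dvd_gcd fun i _ => hp i)
  have hg0 : g ≠ 0 := fun h => hi₀ (by rw [hHG, h, zero_mul])
  have hinvG : ∀ i, IsConstAlong G (G i) := by
    intro i
    by_cases hi : G i = 0
    · intro x t; simp [hi]
    · refine IsConstAlong.of_eq_mul hg0 hHG ((hinv i).of_dvd ?_ ⟨g, by rw [hHG, mul_comm]⟩)
      rw [hHG]
      exact mul_ne_zero hg0 hi
  obtain ⟨r, hr⟩ := isHomogeneous_of_dvd hi₀ (hhom i₀) ⟨G i₀, hHG i₀⟩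
  -- For a nonzero component `d = r + e` holds, so the subtraction does not truncate.
  have hhomG : ∀ i, (G i).IsHomogeneous (d - r) := by
    intro i
    by_cases hi : G i = 0
    · rw [hi]; exact isHomogeneous_zero _ _ _
    · have hHi : H i ≠ 0 := by rw [hHG]; exact mul_ne_zero hg0 hi
      obtain ⟨e, he⟩ := isHomogeneous_of_dvd hHi (hhom i) ⟨g, by rw [hHG, mul_comm]⟩
      have h1 : (H i).IsHomogeneous (r + e) := by rw [hHG]; exact hr.mul he
      have h2 := (hhom i).inj_right h1 hHi
      rwa [h2, Nat.add_sub_cancel_left]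
  refine le_trans (Submodule.finrank_mono (Submodule.span_le.2 ?_))
    (finrank_imageSpan_le_of_primitive hn hhomG hinvG hgcd)
  rintro _ ⟨x, rfl⟩
  have : H.toFun x = eval x g • PolyMap.toFun G x := by
    ext i
    simp [PolyMap.toFun, hHG]
  rw [this]
  exact Submodule.smul_mem _ _ (Submodule.subset_span ⟨x, rfl⟩)

/-- The homogenization `(0, x₀ ^ d H(x / x₀))` of `H`, in one more variable. -/
noncomputable def homogenization (H : PolyMap ℂ n n) (d : ℕ) : PolyMap ℂ (n + 1) (n + 1) :=
  Fin.cons 0 fun i => ∑ k ∈ Finset.range (d + 1),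
    X 0 ^ (d - k) * rename Fin.succ (homogeneousComponent k (H i))

theorem isHomogeneous_homogenization (H : PolyMap ℂ n n) (d : ℕ) (i : Fin (n + 1)) :
    (homogenization H d i).IsHomogeneous d := by
  refine Fin.cases ?_ (fun j => ?_) i
  · exact isHomogeneous_zero _ _ _
  · refine IsHomogeneous.sum _ _ _ fun k hk => ?_
    have h1 := (isHomogeneous_X_pow (R := ℂ) (0 : Fin (n + 1)) (d - k)).mul
      ((homogeneousComponent_isHomogeneous k (H j)).rename_isHomogeneous (f := Fin.succ))
    rwa [Nat.sub_add_cancel (Nat.lt_succ_iff.1 (Finset.mem_range.1 hk))] at h1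

theorem eval_homogenization_succ {H : PolyMap ℂ n n} {d : ℕ} {i : Fin n}
    (hd : (H i).totalDegree ≤ d) {v : Fin (n + 1) → ℂ} (hv : v 0 ≠ 0) :
    eval v (homogenization H d i.succ) = v 0 ^ d * eval ((v 0)⁻¹ • Fin.tail v) (H i) := by
  have hsum : ∑ k ∈ Finset.range (d + 1), homogeneousComponent k (H i) = H i := by
    conv_rhs => rw [← sum_homogeneousComponent (H i)]
    refine (Finset.sum_subset (Finset.range_mono (by omega)) fun k _ hk => ?_).symm
    exact homogeneousComponent_eq_zero _ _ (by simpa using hk)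
  conv_rhs => rw [← hsum]
  rw [map_sum, Finset.mul_sum]
  simp only [homogenization, Fin.cons_succ, map_sum, map_mul, map_pow, eval_X, eval_rename]
  refine Finset.sum_congr rfl fun k hk => ?_
  rw [eval_smul_of_isHomogeneous (homogeneousComponent_isHomogeneous k (H i)), ← mul_assoc,
    pow_sub₀ _ hv (Nat.lt_succ_iff.1 (Finset.mem_range.1 hk)), inv_pow]
  rfl

/-- The zeroth component is `0`, so `x₀` stays fixed along the lines. Where `x₀ ≠ 0`, dividing by
`x₀` turns them into the lines of `H` with rescaled time. -/
theorem isConstAlong_homogenization {H : PolyMap ℂ n n} {d : ℕ}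
    (hd : ∀ i, (H i).totalDegree ≤ d) (hinv : ∀ i, IsConstAlong H (H i)) (i : Fin (n + 1)) :
    IsConstAlong (homogenization H d) (homogenization H d i) := by
  refine Fin.cases (fun x t => ?_) (fun j x t => ?_) i
  · simp [homogenization]
  rw [← eval_bind_shift]
  congr 1
  refine eq_of_eval_eq_of_eval_ne_zero (X_ne_zero 0) fun v hv => ?_
  rw [eval_X] at hv
  have h0 : (v + t • (homogenization H d).toFun v) 0 = v 0 := by
    simp [PolyMap.toFun, homogenization]
  have h1 : (v 0)⁻¹ • Fin.tail (v + t • (homogenization H d).toFun v) =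
      (v 0)⁻¹ • Fin.tail v + ((v 0)⁻¹ * t * v 0 ^ d) • H.toFun ((v 0)⁻¹ • Fin.tail v) := by
    ext k
    simp only [Fin.tail, Pi.smul_apply, Pi.add_apply, smul_eq_mul, PolyMap.toFun,
      eval_homogenization_succ (hd k) hv]
    ring
  rw [eval_bind_shift, eval_homogenization_succ (hd j) (by rwa [h0]),
    eval_homogenization_succ (hd j) hv, h0, h1, hinv j]

theorem finrank_imageSpan_le_homogenization {H : PolyMap ℂ n n} {d : ℕ}
    (hd : ∀ i, (H i).totalDegree ≤ d) :
    Module.finrank ℂ H.imageSpan ≤ Module.finrank ℂ (homogenization H d).imageSpan := by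
  refine le_trans (Submodule.finrank_mono (t := (homogenization H d).imageSpan.map
    (LinearMap.funLeft ℂ ℂ Fin.succ)) (Submodule.span_le.2 ?_)) (Submodule.finrank_map_le _ _)
  rintro _ ⟨x, rfl⟩
  refine ⟨(homogenization H d).toFun (Fin.cons 1 x), Submodule.subset_span ⟨_, rfl⟩, ?_⟩
  ext i
  rw [LinearMap.funLeft_apply, PolyMap.toFun, eval_homogenization_succ (hd i) (by simp)]
  simp [PolyMap.toFun]

/-- The homogenization lives in dimension `n + 1 ≤ 4`, where the homogeneous bound `(n + 1) - 2` is
`n - 1`. -/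
theorem finrank_imageSpan_le_of_isConstAlong (hn : n ≤ 3) {H : PolyMap ℂ n n}
    (hinv : ∀ i, IsConstAlong H (H i)) : Module.finrank ℂ H.imageSpan ≤ max (n - 1) 1 := by
  have hd : ∀ i, (H i).totalDegree ≤ Finset.univ.sup fun i => (H i).totalDegree := fun i =>
    Finset.le_sup (f := fun i => (H i).totalDegree) (Finset.mem_univ i)
  exact (finrank_imageSpan_le_homogenization hd).trans
    (finrank_imageSpan_le_of_isHomogeneous (by omega) (isHomogeneous_homogenization H _)
      (isConstAlong_homogenization hd hinv))

end Main

theorem mainTheorem8 (n : ℕ) (hn : 1 ≤ n) (H : PolyMap ℂ n n)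
    (hH : PolyMap.IsQuasiTranslation H) :
    (n ≤ 3 → Module.finrank ℂ (PolyMap.imageSpan H) ≤ max (n - 1) 1) ∧
    (PolyMap.IsHomogeneous H → n ≤ 4 →
      Module.finrank ℂ (PolyMap.imageSpan H) ≤ max (n - 2) 1) ∧
    ((n ≤ 3 ∨ (PolyMap.IsHomogeneous H ∧ n ≤ 4)) →
      Module.finrank ℂ (PolyMap.imageSpan H) ≤ 2) := by
  have hinv := isConstAlong_of_isQuasiTranslation hH
  have h1 : n ≤ 3 → Module.finrank ℂ (PolyMap.imageSpan H) ≤ max (n - 1) 1 := fun h =>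
    finrank_imageSpan_le_of_isConstAlong h hinv
  have h2 : PolyMap.IsHomogeneous H → n ≤ 4 →
      Module.finrank ℂ (PolyMap.imageSpan H) ≤ max (n - 2) 1 := by
    rintro ⟨d, hd⟩ h
    refine finrank_imageSpan_le_of_isHomogeneous h (d := d) (fun i => ?_) hinv
    rcases hd i with hi | hi
    · rw [hi]
      exact isHomogeneous_zero _ _ _
    · exact hi
  refine ⟨h1, h2, ?_⟩
  rintro (h | ⟨hh, h⟩)
  · exact (h1 h).trans (by omega)
  · exact (h2 hh h).trans (by omega)
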